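/- Theorem B (Genericity). Let $m\ge 2$, and set $C_m=\frac{(m-1)^2}{384\,m^2(2m-1)^2}$ and $d_m=\frac{C_m}{16\ln(2m-1)}$; then $0<d_m<1$. Definitions. Let $A$ be a finite alphabet, $F(A)$ the free group on $A$, whose elements are the reduced words in $A\cup A^{-1}$, and $|\cdot|$ the word length; subwords are contiguous. A reduced word is cyclically reduced if its first and last letters are not mutually inverse. A finite set $\mathcal R\subset F(A)$ is symmetrized if it is closed under inverses and cyclic permutations; the symmetrization $\mathcal R^*$ of $\mathcal R$ is its closure under these operations. A piece is a nontrivial reduced word that is an initial subword of two distinct elements of $\mathcal R$. For a word $u$ and $a\in A$ let $\#_{a^{\pm}}(u)$ be the total number of occurrences of $a$ and $a^{-1}$ in $u$. For $0<\lambda<1$, a finite presentation $G=\langle A\mid\mathcal R\rangle$ is a $\lambda$-translation-apparent presentation of the marked group $(G,S)$ if 1. $S$ is the set of the elements of $G$ represented by the letters in $A\cup A^{-1}$; 2. $\mathcal R$ is symmetrized, consists of cyclically reduced words, and satisfies $C'(\lambda)$: $|w|<\lambda|r|$ for every piece $w$ and every $r\in\mathcal R$ that contains $w$ as a subword; 3.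 every $r\in\mathcal R$ satisfies: (i) if $s^n$ is a subword of $r$ with $s\in A\cup A^{-1}$, then $n<\lambda|r|$; (ii) $\#_{a^\pm}(u)<\frac12\#_{a^\pm}(r)$ for every $a\in A$ and every subword $u$ of $r$ with $|u|=\lceil 4\lambda|r|\rceil$; (iii) $\#_{a^\pm}(u)>\frac{1}{8|A|}|u|$ for every $a\in A$ and every subword $u$ of $r$ with $|u|=\lceil\lambda|r|\rceil$. For $0\le d\le 1$ and $\ell\ge 1$, let $A=\{a_1,\dots,a_m\}$, let $\mathcal R_\ell$ be the set of words obtained by choosing $\lfloor(2m-1)^{d\ell}\rfloor$ cyclically reduced words of length $\ell$ in $F(A)$ independently, uniformly and with replacement, let $G_\ell=F(A)/\langle\langle\mathcal R_\ell\rangle\rangle$, and let $S_\ell\subset G_\ell$ be the image of $A\cup A^{-1}$. Claim. For every density $0\le d<d_m$, the probability that $(G_\ell,S_\ell)$ admits a $\frac1{16}$-translation-apparent presentation tends to $1$ as $\ell\to\infty$. In fact, the probability that the symmetrization $\langle A\mid\mathcal R_\ell^*\rangle$ of the random presentation is itself a $\frac1{16}$-translation-apparent presentation of $(G_\ell,S_\ell)$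 tends to $1$ as $\ell\to\infty$. -/

import Mathlib

open MeasureTheory ProbabilityTheory Filter Topology

/-! ### Presentations

A finite alphabet `A` is a finite type `α`, the free group `F(A)` is `FreeGroup α`, and the reduced
word of `g : FreeGroup α` is the list `g.toWord`; a letter is a pair `(a, true)` (for `a`) or
`(a, false)` (for `a⁻¹`). Subwords (`<:+:`) and initial subwords (`<+:`) are contiguous. -/

/-- `⟨A | R⟩` is a finite presentation of `G`, where the letter `a` stands for the element `φ a`
of `G`: the induced homomorphism `F(A) → G` is onto, with kernel the normal closure of `R`. -/
structure IsFinitePresentation {α G : Type*} [Group G] (φ : α → G)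
    (R : Set (FreeGroup α)) : Prop where
  finite_alphabet : Finite α
  finite_relators : R.Finite
  surjective : Function.Surjective (FreeGroup.lift φ)
  ker_eq : (FreeGroup.lift φ).ker = Subgroup.normalClosure R

/-- Every relator is cyclically reduced. -/
def CyclicallyReducedRelators {α : Type*} [DecidableEq α] (R : Set (FreeGroup α)) : Prop :=
  ∀ r ∈ R, FreeGroup.IsCyclicallyReduced r.toWord

/-- The symmetrization of `R`: its closure under cyclic permutations and inverses. -/
inductive Symmetrization {α : Type*} [DecidableEq α] (R : Set (FreeGroup α)) :
    FreeGroup α → Prop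
  | base (r : FreeGroup α) (hr : r ∈ R) : Symmetrization R r
  | rotate (r : FreeGroup α) (n : ℕ) (hr : Symmetrization R r) :
      Symmetrization R (FreeGroup.mk (r.toWord.rotate n))
  | inv (r : FreeGroup α) (hr : Symmetrization R r) : Symmetrization R r⁻¹

/-- The symmetrization of `R` as a set of relators. -/
def symmetrization {α : Type*} [DecidableEq α] (R : Set (FreeGroup α)) : Set (FreeGroup α) :=
  {g | Symmetrization R g}

/-- `R` is symmetrized: it is closed under cyclic permutations and inverses. -/
def IsSymmetrized {α : Type*} [DecidableEq α] (R : Set (FreeGroup α)) : Prop :=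
  ∀ r ∈ R, r⁻¹ ∈ R ∧ ∀ n : ℕ, FreeGroup.mk (r.toWord.rotate n) ∈ R

/-- A piece: a nontrivial `w` that is an initial subword of two distinct relators. -/
def IsPiece {α : Type*} [DecidableEq α] (R : Set (FreeGroup α)) (w : FreeGroup α) : Prop :=
  w ≠ 1 ∧ ∃ r ∈ R, ∃ r' ∈ R, r ≠ r' ∧ w.toWord <+: r.toWord ∧ w.toWord <+: r'.toWord

/-- The small cancellation condition `C'(lam)`. -/
def SmallCancellation {α : Type*} [DecidableEq α] (lam : ℝ) (R : Set (FreeGroup α)) : Prop :=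
  ∀ w : FreeGroup α, IsPiece R w → ∀ r ∈ R, w.toWord <:+: r.toWord →
    (w.toWord.length : ℝ) < lam * (r.toWord.length : ℝ)

/-- The total number of occurrences of `a` and of `a⁻¹` in the word `u`. -/
def occurrences {α : Type*} [DecidableEq α] (a : α) (u : List (α × Bool)) : ℕ :=
  u.count (a, true) + u.count (a, false)

/-- The even distribution conditions with parameter `lam` for one relator, with word `r`. -/
structure EvenlyDistributed {α : Type*} [Fintype α] [DecidableEq α] (lam : ℝ)
    (r : List (α × Bool)) : Prop where
  powers : ∀ (s : α × Bool) (n : ℕ), List.replicate n s <:+: r → (n : ℝ) < lam * (r.length : ℝ)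
  lt_half : ∀ (a : α) (u : List (α × Bool)), u <:+: r → u.length = ⌈4 * lam * (r.length : ℝ)⌉₊ →
    (occurrences a u : ℝ) < 1 / 2 * (occurrences a r : ℝ)
  gt_fraction : ∀ (a : α) (u : List (α × Bool)), u <:+: r → u.length = ⌈lam * (r.length : ℝ)⌉₊ →
    1 / (8 * (Fintype.card α : ℝ)) * (u.length : ℝ) < (occurrences a u : ℝ)

/-- `⟨A | R⟩` is a `lam`-translation-apparent presentation for the marked group `(G, S)`, where
the letter `a` stands for the element `φ a` of `G`. -/
structure IsTranslationApparent {α G : Type*} [Fintype α] [DecidableEq α] [Group G] (lam : ℝ)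
    (S : Set G) (φ : α → G) (R : Set (FreeGroup α)) : Prop where
  presentation : IsFinitePresentation φ R
  marking : S = Set.range φ ∪ (Set.range φ)⁻¹
  symmetrized : IsSymmetrized R
  cyclicallyReduced : CyclicallyReducedRelators R
  smallCancellation : SmallCancellation lam R
  evenlyDistributed : ∀ r ∈ R, EvenlyDistributed lam r.toWord

/-- The marked group `(G, S)` admits a `lam`-translation-apparent presentation. -/
def AdmitsTranslationApparent {G : Type*} [Group G] (lam : ℝ) (S : Set G) : Prop :=
  ∃ (n : ℕ) (φ : Fin n → G) (R : Set (FreeGroup (Fin n))), IsTranslationApparent lam S φ R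

/-! ### Random groups in the density model -/

/-- Cyclically reduced words of length `l` on `m` letters. -/
def CycRedWord (m l : ℕ) : Type :=
  {g : FreeGroup (Fin m) // g.toWord.length = l ∧ FreeGroup.IsCyclicallyReduced g.toWord}

instance (m l : ℕ) : MeasurableSpace (CycRedWord m l) := ⊤

instance (m l : ℕ) : DiscreteMeasurableSpace (CycRedWord m l) := ⟨fun _ => trivial⟩

/-- The number of random relators of length `l` at density `d`: `(2m-1)^(dl)`, rounded down. -/
noncomputable def numRelators (m : ℕ) (d : ℝ) (l : ℕ) : ℕ :=
  ⌊(2 * (m : ℝ) - 1) ^ (d * (l : ℝ))⌋₊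

/-- The law of the random relators: independent (so, with replacement), each one uniformly
distributed on the cyclically reduced words of length `l`. -/
noncomputable def relatorLaw (m : ℕ) (d : ℝ) (l : ℕ) :
    Measure (Fin (numRelators m d l) → CycRedWord m l) :=
  Measure.pi fun _ => uniformOn Set.univ

/-- The set of relators given by a tuple of words. -/
def relatorSet {m l N : ℕ} (ω : Fin N → CycRedWord m l) : Set (FreeGroup (Fin m)) :=
  Set.range fun i => (ω i).1

/-- The group `F(A)/⟨⟨R⟩⟩` given by a tuple of words. -/
abbrev relatorGroup {m l N : ℕ} (ω : Fin N → CycRedWord m l) : Type :=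
  PresentedGroup (relatorSet ω)

/-- The natural generators, the images of the letters. -/
def relatorGroupGen {m l N : ℕ} (ω : Fin N → CycRedWord m l) (a : Fin m) : relatorGroup ω :=
  PresentedGroup.of a

/-- The natural symmetric generating set of that group. -/
def relatorGroupMarking {m l N : ℕ} (ω : Fin N → CycRedWord m l) : Set (relatorGroup ω) :=
  Set.range (relatorGroupGen ω) ∪ (Set.range (relatorGroupGen ω))⁻¹

/-- `C_m = (m-1)² / (384 m² (2m-1)²)`. -/
noncomputable def chernoffConst (m : ℕ) : ℝ :=
  ((m : ℝ) - 1) ^ 2 / (384 * (m : ℝ) ^ 2 * (2 * (m : ℝ) - 1) ^ 2)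

/-- `d_m = C_m / (16 ln(2m-1))`. -/
noncomputable def densityBound (m : ℕ) : ℝ :=
  chernoffConst m / (16 * Real.log (2 * (m : ℝ) - 1))

/-! Every defect of the symmetrized presentation can be read off a prefix. The symmetrization is
closed under rotation, so a subword of a relator is a prefix of another relator, and each relator is
a rotation of a drawn word or of its inverse. Rotations and inversion permute the cyclically reduced
words of length l, so a rotated draw is again uniform, and it is enough to bound the probability
that one uniform word is bad as it stands (`IsExceptional`) or that two independent ones agree on a
prefix of length ⌈l/16⌉.

Let K = 2m - 1. There are at least K^(l-2) cyclically reduced words, and each kind of bad word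
accounts for at most a constant times exp(-l/(60K)) K^l reduced words, for one of two reasons. A
long power, a prescribed prefix, or an overlap with a rotation of the word or of its inverse makes
about l/16 letters redundant (`card_le_exceptionalBound_of_injOn`). An atypical number of
occurrences of a letter is excluded by an exponential moment bound, in which multiplicative weights
are summed over reduced words one letter at a time (`card_occurrences_take_le`,
`card_occurrences_drop_le`).

Below the critical density there are at most exp(l/(1000K)) relators. The union bound over pairs of
draws and over rotations costs the square of this times a polynomial in l, which exp(-l/(60K))
beats. That the absence of bad events suffices is
`isTranslationApparent_of_forall_not_isExceptional`. -/

section Words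

variable {α : Type*} {w w' u v : List (α × Bool)}

/-! ### Reduced and cyclically reduced words under inversion and rotation -/

namespace FreeGroup

theorem IsReduced.invRev (h : IsReduced w) : IsReduced (invRev w) := by
  unfold IsReduced FreeGroup.invRev at *
  rw [List.isChain_reverse, List.isChain_map]
  refine h.imp ?_
  rintro ⟨a, x⟩ ⟨b, y⟩ h1 h2
  simp_all

theorem IsCyclicallyReduced.invRev (h : IsCyclicallyReduced w) :
    IsCyclicallyReduced (invRev w) := by
  refine ⟨h.1.invRev, ?_⟩
  intro a ha b hb hab
  simp only [FreeGroup.invRev, List.getLast?_reverse, List.head?_reverse, List.head?_map,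
    List.getLast?_map, Option.mem_def, Option.map_eq_some_iff] at ha hb
  obtain ⟨a', ha', rfl⟩ := ha
  obtain ⟨b', hb', rfl⟩ := hb
  simpa using (h.2 b' hb' a' ha' hab.symm).symm

theorem IsCyclicallyReduced.append_comm (h : IsCyclicallyReduced (u ++ v)) :
    IsCyclicallyReduced (v ++ u) := by
  rcases eq_or_ne u [] with rfl | hu
  · simpa using h
  rcases eq_or_ne v [] with rfl | hv
  · simpa using h
  obtain ⟨h1, h2⟩ := h
  unfold IsReduced at h1
  rw [List.isChain_append] at h1
  rw [List.getLast?_append_of_ne_nil _ hv, List.head?_append_of_ne_nil _ hu] at h2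
  refine ⟨?_, ?_⟩
  · unfold IsReduced
    rw [List.isChain_append]
    exact ⟨h1.2.1, h1.1, h2⟩
  · rw [List.getLast?_append_of_ne_nil _ hu, List.head?_append_of_ne_nil _ hv]
    exact h1.2.2

theorem IsCyclicallyReduced.rotate (h : IsCyclicallyReduced w) (n : ℕ) :
    IsCyclicallyReduced (w.rotate n) := by
  rw [List.rotate_eq_drop_append_take_mod]
  apply IsCyclicallyReduced.append_comm
  rwa [List.take_append_drop]

theorem IsCyclicallyReduced.of_isRotated (h : IsCyclicallyReduced w) (h' : w ~r w') :
    IsCyclicallyReduced w' := by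
  obtain ⟨n, rfl⟩ := h'
  exact h.rotate n

theorem invRev_isRotated (h : w ~r w') : invRev w ~r invRev w' := (h.map _).reverse

end FreeGroup

open FreeGroup

/-! ### Words overlapping a rotation of themselves or of their inverse -/

theorem List.getElem?_invRev {n : ℕ} (hn : n < w.length) :
    (invRev w)[n]? = (w[w.length - 1 - n]?).map fun c => (c.1, !c.2) := by
  rw [invRev, List.getElem?_reverse (by simpa using hn)]
  simp

/-- A word sharing a prefix of length `p` with its rotation by `k` is determined by the letters
outside the positions `k, …, k + p - 1`. -/
theorem eq_of_take_eq_take_rotate {k p : ℕ} (hk : 0 < k) (hkp : k + p ≤ w.length)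
    (hl : w.length = w'.length) (h : w.take p = (w.rotate k).take p)
    (h' : w'.take p = (w'.rotate k).take p) (ht : w.take k = w'.take k)
    (hd : w.drop (k + p) = w'.drop (k + p)) : w = w' := by
  have key : ∀ (z : List (α × Bool)), k + p ≤ z.length → z.take p = (z.rotate k).take p →
      ∀ t < p, z[t + k]? = z[t]? := by
    intro z hz hzz t htp
    have := congrArg (fun y => y[t]?) hzz
    simp only [List.getElem?_take, htp, if_true] at this
    rw [this, List.getElem?_rotate (by omega), Nat.mod_eq_of_lt (by omega)]
  refine List.ext_getElem? fun n => ?_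
  -- Each letter of the window is a copy of the one k places earlier. That one may lie in the window
  -- too, when k < p, hence the induction from the left.
  induction n using Nat.strong_induction_on with
  | _ n ih =>
    by_cases h1 : n < k
    · have := congrArg (fun y => y[n]?) ht
      simpa [List.getElem?_take, h1] using this
    · by_cases h2 : n < k + p
      · obtain ⟨t, rfl⟩ : ∃ t, n = t + k := ⟨n - k, by omega⟩
        rw [key w hkp h t (by omega), key w' (hl ▸ hkp) h' t (by omega)]
        exact ih t (by omega)
      · obtain ⟨t, rfl⟩ : ∃ t, n = k + p + t := ⟨n - (k + p), by omega⟩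
        have := congrArg (fun y => y[t]?) hd
        simpa [List.getElem?_drop] using this

/-- A prefix shared with a rotated inverse makes the word antisymmetric under the reflection t ↦ l -
1 - k - t, where l is the length; `htk` keeps the rotation from wrapping around. -/
theorem getElem?_of_take_eq_take_rotate_invRev {k p : ℕ} (hk : k < w.length) (hp : p ≤ w.length)
    (h : w.take p = ((invRev w).rotate k).take p) {t : ℕ} (ht : t < p)
    (htk : t ≤ w.length - 1 - k) :
    w[t]? = (w[w.length - 1 - k - t]?).map fun c => (c.1, !c.2) := by
  have := congrArg (fun y => y[t]?) h
  simp only [List.getElem?_take, ht, if_true] at this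
  rw [this, List.getElem?_rotate (by simp; omega), invRev_length,
    Nat.mod_eq_of_lt (by omega), List.getElem?_invRev (by omega)]
  congr 2
  omega

theorem FreeGroup.IsReduced.getElem?_succ_ne (hw : IsReduced w) {t : ℕ} (ht : t + 1 < w.length) :
    w[t]? ≠ (w[t + 1]?).map fun c => (c.1, !c.2) := by
  have := List.isChain_iff_getElem.1 hw t ht
  rw [List.getElem?_eq_getElem ht, List.getElem?_eq_getElem (by omega)]
  intro h
  simp only [Option.map_some, Option.some.injEq] at h
  rw [h] at this
  simp at this

/-- A reduced word sharing a prefix with a rotation of its inverse does so disjointly. -/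
theorem two_mul_le_of_take_eq_take_rotate_invRev {k p : ℕ} (hw : IsReduced w) (hk : k < w.length)
    (hp : p ≤ w.length) (h : w.take p = ((invRev w).rotate k).take p) :
    2 * p ≤ w.length - k := by
  by_contra! hlt
  obtain ⟨c, hc⟩ : ∃ c, w.length - 1 - k = c := ⟨_, rfl⟩
  -- If the prefix reached the centre of the reflection, the central letter would be its own
  -- inverse, or the two central letters would cancel.
  rcases Nat.even_or_odd' c with ⟨t, ht | ht⟩
  · have := getElem?_of_take_eq_take_rotate_invRev hk hp h (t := t) (by omega) (by omega)
    rw [show w.length - 1 - k - t = t by omega, List.getElem?_eq_getElem (by omega)] at this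
    simp [Prod.ext_iff] at this
  · have := getElem?_of_take_eq_take_rotate_invRev hk hp h (t := t) (by omega) (by omega)
    rw [show w.length - 1 - k - t = t + 1 by omega] at this
    exact hw.getElem?_succ_ne (by omega) this

/-- A reduced word sharing a prefix of length `p` with a rotation of its inverse is determined by
the letters outside some interval of length `p`. -/
theorem eq_of_take_eq_take_rotate_invRev {k p : ℕ} (hw : IsReduced w) (hk : k < w.length)
    (hp : p ≤ w.length) (hl : w.length = w'.length)
    (h : w.take p = ((invRev w).rotate k).take p)
    (h' : w'.take p = ((invRev w').rotate k).take p)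
    (ht : w.take (w.length - k - p) = w'.take (w.length - k - p))
    (hd : w.drop (w.length - k) = w'.drop (w.length - k)) : w = w' := by
  have h2p := two_mul_le_of_take_eq_take_rotate_invRev hw hk hp h
  have h1 : ∀ n < w.length - k - p, w[n]? = w'[n]? := by
    intro n hn
    have := congrArg (fun y => y[n]?) ht
    simpa [List.getElem?_take, hn] using this
  refine List.ext_getElem? fun n => ?_
  by_cases hn1 : n < w.length - k - p
  · exact h1 n hn1
  by_cases hn2 : n < w.length - k
  -- The mirror image t of n satisfies t < p ≤ l - k - p by `h2p`, so its letter is already known.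
  · obtain ⟨t, htn⟩ : ∃ t, t = w.length - 1 - k - n := ⟨_, rfl⟩
    have e := getElem?_of_take_eq_take_rotate_invRev hk hp h (t := t) (by omega) (by omega)
    have e' := getElem?_of_take_eq_take_rotate_invRev (hl ▸ hk) (hl ▸ hp) h' (t := t) (by omega)
      (by omega)
    rw [← hl] at e'
    rw [show w.length - 1 - k - t = n by omega] at e e'
    rw [h1 t (by omega), e'] at e
    refine (Option.map_injective ?_ e).symm
    rintro ⟨a, x⟩ ⟨b, y⟩ hab
    simpa using hab
  · obtain ⟨t, rfl⟩ : ∃ t, n = w.length - k + t := ⟨n - (w.length - k), by omega⟩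
    have := congrArg (fun y => y[t]?) hd
    simpa [List.getElem?_drop] using this

/-! ### Occurrences of a letter, and subwords as prefixes of rotations -/

section Occurrences

variable [DecidableEq α]

theorem occurrences_append (a : α) (u v : List (α × Bool)) :
    occurrences a (u ++ v) = occurrences a u + occurrences a v := by
  simp only [occurrences, List.count_append]
  omega

theorem occurrences_eq_of_perm (a : α) (h : u.Perm v) : occurrences a u = occurrences a v := by
  simp only [occurrences, h.count_eq]

theorem occurrences_cons (a : α) (c : α × Bool) (u : List (α × Bool)) :
    occurrences a (c :: u) = occurrences a u + if c.1 = a then 1 else 0 := by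
  obtain ⟨b, x⟩ := c
  by_cases h : b = a <;> cases x <;> simp [occurrences, h] <;> omega

theorem prod_map_ite_eq_pow_occurrences (a : α) (x : ℝ) (u : List (α × Bool)) :
    (u.map fun c => if c.1 = a then x else 1).prod = x ^ occurrences a u := by
  induction u with
  | nil => simp [occurrences]
  | cons c u ih =>
    rw [List.map_cons, List.prod_cons, ih, occurrences_cons]
    split_ifs
    · rw [pow_succ, mul_comm]
    · simp

end Occurrences

theorem List.IsInfix.exists_isRotated_take {l r : List (α × Bool)} (h : l <:+: r) :
    ∃ r', r ~r r' ∧ r'.take l.length = l := by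
  obtain ⟨s, t, rfl⟩ := h
  refine ⟨l ++ t ++ s, ⟨s.length, ?_⟩, by simp⟩
  rw [List.append_assoc, List.rotate_append_length_eq]

end Words

/-! ### Weighted counting of reduced words -/

section Counting

open FreeGroup

theorem Finset.sum_biUnion_le_sum {ι κ : Type*} [DecidableEq κ] {F : κ → ℝ} (hF : ∀ x, 0 ≤ F x)
    (s : Finset ι) (t : ι → Finset κ) : ∑ x ∈ s.biUnion t, F x ≤ ∑ i ∈ s, ∑ x ∈ t i, F x := by
  classical
  induction s using Finset.induction_on with
  | empty => simp
  | insert i s hi ih =>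
    rw [Finset.biUnion_insert, Finset.sum_insert hi]
    have h1 := Finset.sum_union_inter (s₁ := t i) (s₂ := s.biUnion t) (f := F)
    have h2 : 0 ≤ ∑ x ∈ t i ∩ s.biUnion t, F x := Finset.sum_nonneg fun x _ => hF x
    linarith

theorem List.prod_map_nonneg {β : Type*} {f : β → ℝ} (hf : ∀ c, 0 ≤ f c) (w : List β) :
    0 ≤ (w.map f).prod :=
  List.prod_nonneg fun x hx => by
    obtain ⟨c, _, rfl⟩ := List.mem_map.1 hx
    exact hf c

variable {α : Type*} [Fintype α] [DecidableEq α]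

/-- The words `w` of length `n` such that `b w` is reduced. -/
def reducedFrom : (b : α × Bool) → ℕ → Finset (List (α × Bool))
  | _, 0 => {[]}
  | b, n + 1 => (Finset.univ.filter fun c : α × Bool => b.1 = c.1 → b.2 = c.2).biUnion
      fun c => (reducedFrom c n).image (List.cons c)

theorem mem_reducedFrom {b : α × Bool} {n : ℕ} {w : List (α × Bool)} :
    w ∈ reducedFrom b n ↔ w.length = n ∧ IsReduced (b :: w) := by
  induction n generalizing b w with
  | zero =>
    simp only [reducedFrom, Finset.mem_singleton, List.length_eq_zero_iff]
    constructor
    · rintro rfl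
      exact ⟨rfl, IsReduced.singleton⟩
    · exact And.left
  | succ n ih =>
    simp only [reducedFrom, Finset.mem_biUnion, Finset.mem_filter, Finset.mem_univ, true_and,
      Finset.mem_image]
    constructor
    · rintro ⟨c, hc, v, hv, rfl⟩
      obtain ⟨hv1, hv2⟩ := ih.1 hv
      exact ⟨by simp [hv1], isReduced_cons_cons.2 ⟨hc, hv2⟩⟩
    · rintro ⟨hl, hw⟩
      obtain _ | ⟨c, v⟩ := w
      · simp at hl
      · obtain ⟨h1, h2⟩ := isReduced_cons_cons.1 hw
        exact ⟨c, h1, v, ih.2 ⟨by simpa using hl, h2⟩, rfl⟩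

theorem sum_reducedFrom_succ (F : List (α × Bool) → ℝ) (b : α × Bool) (n : ℕ) :
    ∑ w ∈ reducedFrom b (n + 1), F w =
      ∑ c : α × Bool with b.1 = c.1 → b.2 = c.2, ∑ w ∈ reducedFrom c n, F (c :: w) := by
  rw [reducedFrom, Finset.sum_biUnion]
  · refine Finset.sum_congr rfl fun c _ => ?_
    rw [Finset.sum_image (fun x _ y _ h => (List.cons.inj h).2)]
  · intro c _ c' _ hcc'
    rw [Function.onFun, Finset.disjoint_left]
    intro w hw hw'
    simp only [Finset.mem_image] at hw hw'
    obtain ⟨x, _, rfl⟩ := hw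
    obtain ⟨y, _, hy⟩ := hw'
    exact hcc' (List.cons.inj hy).1.symm

theorem filter_compatible_eq_erase (b : α × Bool) :
    (Finset.univ.filter fun c : α × Bool => b.1 = c.1 → b.2 = c.2) =
      Finset.univ.erase (b.1, !b.2) := by
  ext ⟨c, y⟩
  obtain ⟨b, x⟩ := b
  rcases eq_or_ne c b with rfl | h
  · cases x <;> cases y <;> simp
  · simp [h, h.symm]

theorem sum_compatible (f : α × Bool → ℝ) (b : α × Bool) :
    ∑ c : α × Bool with b.1 = c.1 → b.2 = c.2, f c = ∑ c, f c - f (b.1, !b.2) := by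
  rw [filter_compatible_eq_erase, ← Finset.sum_erase_add _ _ (Finset.mem_univ (b.1, !b.2))]
  ring

theorem card_reducedFrom (b : α × Bool) (n : ℕ) :
    ((reducedFrom b n).card : ℝ) = (2 * (Fintype.card α : ℝ) - 1) ^ n := by
  have h : ∀ s : Finset (List (α × Bool)), (s.card : ℝ) = ∑ _w ∈ s, 1 := by simp
  induction n generalizing b with
  | zero => simp [reducedFrom]
  | succ n ih =>
    rw [h, sum_reducedFrom_succ]
    rw [Finset.sum_congr rfl fun c _ => (h (reducedFrom c n)).symm.trans (ih c),
      sum_compatible (fun _ => (2 * (Fintype.card α : ℝ) - 1) ^ n) b, Finset.sum_const,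
      Finset.card_univ, Fintype.card_prod, Fintype.card_bool, nsmul_eq_mul]
    push_cast
    ring

/-- After the letter b every letter but its inverse may follow, so M bounds the row sums of the
weighted transfer matrix and each further letter costs at most a factor M. -/
theorem sum_reducedFrom_le {f : α × Bool → ℝ} (hf : ∀ c, 0 ≤ f c) {M : ℝ} (hM : 0 ≤ M)
    (h : ∀ b : α × Bool, ∑ c, f c - f (b.1, !b.2) ≤ M) (b : α × Bool) (n : ℕ) :
    ∑ w ∈ reducedFrom b n, (w.map f).prod ≤ M ^ n := by
  induction n generalizing b with
  | zero => simp [reducedFrom]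
  | succ n ih =>
    rw [sum_reducedFrom_succ]
    simp only [List.map_cons, List.prod_cons, ← Finset.mul_sum]
    calc _ ≤ ∑ c : α × Bool with b.1 = c.1 → b.2 = c.2, f c * M ^ n :=
          Finset.sum_le_sum fun c _ => mul_le_mul_of_nonneg_left (ih c) (hf c)
      _ = (∑ c, f c - f (b.1, !b.2)) * M ^ n := by rw [← Finset.sum_mul, sum_compatible]
      _ ≤ M * M ^ n := by gcongr; exact h b
      _ = M ^ (n + 1) := by ring

/-- The reduced words of length `n`. -/
def reducedWords (α : Type*) [Fintype α] [DecidableEq α] (n : ℕ) : Finset (List (α × Bool)) :=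
  Finset.univ.biUnion fun b => reducedFrom b n

theorem mem_reducedWords [Nonempty α] {n : ℕ} {w : List (α × Bool)} :
    w ∈ reducedWords α n ↔ w.length = n ∧ IsReduced w := by
  simp only [reducedWords, Finset.mem_biUnion, Finset.mem_univ, true_and, mem_reducedFrom]
  constructor
  · rintro ⟨b, h1, h2⟩
    exact ⟨h1, h2.infix ⟨[b], [], by simp⟩⟩
  · rintro ⟨h1, h2⟩
    obtain _ | ⟨c, w⟩ := w
    · exact ⟨(Classical.arbitrary α, true), h1, IsReduced.singleton⟩
    · exact ⟨c, h1, isReduced_cons_cons.2 ⟨fun _ => rfl, h2⟩⟩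

/-- The factor 2m counts the virtual letters preceding the word. Words are counted several times,
which is harmless in an upper bound. -/
theorem sum_reducedWords_le {f : α × Bool → ℝ} (hf : ∀ c, 0 ≤ f c) {M : ℝ} (hM : 0 ≤ M)
    (h : ∀ b : α × Bool, ∑ c, f c - f (b.1, !b.2) ≤ M) (n : ℕ) :
    ∑ w ∈ reducedWords α n, (w.map f).prod ≤ 2 * (Fintype.card α : ℝ) * M ^ n := by
  calc _ ≤ ∑ b : α × Bool, ∑ w ∈ reducedFrom b n, (w.map f).prod :=
        Finset.sum_biUnion_le_sum (List.prod_map_nonneg hf) _ _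
      _ ≤ ∑ b : α × Bool, M ^ n := Finset.sum_le_sum fun b _ => sum_reducedFrom_le hf hM h b n
      _ = _ := by
        rw [Finset.sum_const, Finset.card_univ, Fintype.card_prod, Fintype.card_bool, nsmul_eq_mul]
        push_cast
        ring

/-- Words in `T` are determined by, and weighted through, a prefix of length `k` and the suffix
starting at `j`. -/
theorem card_le_of_injOn_take_drop [Nonempty α] {k j l : ℕ} (hkj : k ≤ j) (hjl : j ≤ l)
    {T : Finset (List (α × Bool))} (hT : T ⊆ reducedWords α l)
    (hinj : ∀ w ∈ T, ∀ w' ∈ T, w.take k = w'.take k → w.drop j = w'.drop j → w = w')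
    {f g : α × Bool → ℝ} (hf : ∀ c, 0 ≤ f c) (hg : ∀ c, 0 ≤ g c) {M N C : ℝ} (hM : 0 ≤ M)
    (hN : 0 ≤ N) (hfM : ∀ b : α × Bool, ∑ c, f c - f (b.1, !b.2) ≤ M)
    (hgN : ∀ b : α × Bool, ∑ c, g c - g (b.1, !b.2) ≤ N)
    (hC : ∀ w ∈ T, C ≤ ((w.take k).map f).prod * ((w.drop j).map g).prod) :
    T.card * C ≤ (2 * (Fintype.card α : ℝ)) ^ 2 * (M ^ k * N ^ (l - j)) := by
  calc (T.card : ℝ) * C = ∑ w ∈ T, C := by simp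
    _ ≤ ∑ w ∈ T, ((w.take k).map f).prod * ((w.drop j).map g).prod := Finset.sum_le_sum hC
    _ = ∑ z ∈ T.image fun w => (w.take k, w.drop j), (z.1.map f).prod * (z.2.map g).prod := by
        rw [Finset.sum_image]
        intro w hw w' hw' h
        simp only [Prod.mk.injEq] at h
        exact hinj w hw w' hw' h.1 h.2
    -- Compatibility between prefix and suffix is dropped, so that the sum factors.
    _ ≤ ∑ z ∈ reducedWords α k ×ˢ reducedWords α (l - j),
          (z.1.map f).prod * (z.2.map g).prod := by
        refine Finset.sum_le_sum_of_subset_of_nonneg ?_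
          fun z _ _ => mul_nonneg (List.prod_map_nonneg hf _) (List.prod_map_nonneg hg _)
        intro z hz
        simp only [Finset.mem_image] at hz
        obtain ⟨w, hw, rfl⟩ := hz
        obtain ⟨h1, h2⟩ := mem_reducedWords.1 (hT hw)
        rw [Finset.mem_product, mem_reducedWords, mem_reducedWords]
        exact ⟨⟨by simp; omega, h2.infix (List.take_prefix _ _).isInfix⟩,
          ⟨by simp; omega, h2.infix (List.drop_suffix _ _).isInfix⟩⟩
    _ = (∑ u ∈ reducedWords α k, (u.map f).prod) *
          ∑ v ∈ reducedWords α (l - j), (v.map g).prod := by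
        rw [Finset.sum_product, Finset.sum_mul_sum]
    _ ≤ (2 * (Fintype.card α : ℝ) * M ^ k) * (2 * (Fintype.card α : ℝ) * N ^ (l - j)) :=
        mul_le_mul (sum_reducedWords_le hf hM hfM k) (sum_reducedWords_le hg hN hgN _)
          (Finset.sum_nonneg fun v _ => List.prod_map_nonneg hg v) (by positivity)
    _ = _ := by ring

end Counting

/-! ### Exponentially small families of words -/

section WordBounds

open FreeGroup

theorem sum_one_sub_le {α : Type*} [Fintype α] (_b : α × Bool) :
    ∑ _c : α × Bool, (1 : ℝ) - 1 ≤ 2 * (Fintype.card α : ℝ) - 1 := by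
  rw [Finset.sum_const, Finset.card_univ, Fintype.card_prod, Fintype.card_bool, nsmul_eq_mul]
  push_cast
  linarith

variable {α : Type*} [Fintype α] [DecidableEq α]

theorem sum_ite_fst_eq (a : α) (x : ℝ) :
    ∑ c : α × Bool, (if c.1 = a then x else 1) = 2 * x + 2 * ((Fintype.card α : ℝ) - 1) := by
  rw [Fintype.sum_prod_type]
  have : ∀ b : α, ∑ _y : Bool, (if b = a then x else 1) = 2 + if b = a then 2 * (x - 1) else 0 := by
    intro b
    split_ifs <;> simp
    ring
  simp only [this, Finset.sum_add_distrib, Finset.sum_ite_eq', Finset.mem_univ, if_true,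
    Finset.sum_const, Finset.card_univ, nsmul_eq_mul]
  ring

/-- The worst row for x ≤ 1 follows a letter a or its inverse, where the forbidden letter is one of
the two light ones. For x ≥ 1, in the next lemma, it follows any other letter. -/
theorem sum_ite_fst_sub_le_of_le_one (a : α) {x : ℝ} (hx : x ≤ 1) (b : α × Bool) :
    ∑ c : α × Bool, (if c.1 = a then x else 1) - (if b.1 = a then x else 1) ≤
      2 * (Fintype.card α : ℝ) - 1 - (1 - x) := by
  rw [sum_ite_fst_eq]
  split_ifs <;> linarith

theorem sum_ite_fst_sub_le_of_one_le (a : α) {x : ℝ} (hx : 1 ≤ x) (b : α × Bool) :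
    ∑ c : α × Bool, (if c.1 = a then x else 1) - (if b.1 = a then x else 1) ≤
      2 * (Fintype.card α : ℝ) - 1 + 2 * (x - 1) := by
  rw [sum_ite_fst_eq]
  split_ifs <;> linarith

/-- From 1 + t ≤ exp t: a row sum K + y means growth at relative rate at most y / K per letter. -/
theorem pow_le_exp_mul_pow {K y : ℝ} (hK : 0 < K) (hy : 0 ≤ K + y) (n : ℕ) :
    (K + y) ^ n ≤ Real.exp (n * (y / K)) * K ^ n := by
  have h : K + y ≤ Real.exp (y / K) * K := by
    have := Real.add_one_le_exp (y / K)
    calc K + y = (y / K + 1) * K := by field_simp; ring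
      _ ≤ _ := by gcongr
  calc (K + y) ^ n ≤ (Real.exp (y / K) * K) ^ n := by gcongr
    _ = _ := by rw [mul_pow, ← Real.exp_nat_mul]

/-- As K ≥ 3 > e, losing p letters saves at least exp(l/16). The weak right side is the common form
that also fits the occurrence bounds. -/
theorem pow_sub_le_exp_mul_pow {K : ℝ} (hK : 3 ≤ K) {p l : ℕ} (hp : (l : ℝ) / 16 ≤ p)
    (hpl : p ≤ l) : K ^ (l - p) ≤ Real.exp 1 * Real.exp (-(l / (60 * K))) * K ^ l := by
  have h1 : Real.exp p ≤ K ^ p := by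
    rw [← Real.exp_one_pow]
    have := Real.exp_one_lt_d9
    gcongr
    linarith
  have h2 : (l : ℝ) / (60 * K) ≤ p := by
    refine le_trans ?_ hp
    gcongr
    linarith
  calc K ^ (l - p) = 1 * K ^ (l - p) := by ring
    _ ≤ (Real.exp 1 * Real.exp (-(l / (60 * K))) * K ^ p) * K ^ (l - p) := by
        gcongr
        calc (1 : ℝ) ≤ Real.exp (1 + -(l / (60 * K)) + p) := Real.one_le_exp (by linarith)
          _ = Real.exp 1 * Real.exp (-(l / (60 * K))) * Real.exp p := by
            rw [Real.exp_add, Real.exp_add]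
          _ ≤ _ := by gcongr
    _ = _ := by rw [mul_assoc _ (K ^ p), ← pow_add, Nat.add_sub_cancel' hpl]

/-- The exponential bound, relative to `K ^ l`, on the number of exceptional words of length `l`. -/
noncomputable def exceptionalBound (m l : ℕ) : ℝ :=
  (2 * (m : ℝ)) ^ 2 * (Real.exp 1 * Real.exp (-(l / (60 * (2 * (m : ℝ) - 1)))) *
    (2 * (m : ℝ) - 1) ^ l)

/-- There are many cyclically reduced words. -/
theorem exists_card_cyclicallyReduced_ge (hα : 2 ≤ Fintype.card α) (n : ℕ) :
    ∃ T : Finset (List (α × Bool)), (∀ w ∈ T, w.length = n + 2 ∧ IsCyclicallyReduced w) ∧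
      (T.card : ℝ) = (2 * (Fintype.card α : ℝ) - 1) ^ n := by
  obtain ⟨a, a', haa'⟩ := Fintype.exists_pair_of_one_lt_card (α := α) (by omega)
  -- The words built are a, then any reduced continuation, then a closing letter c which cancels
  -- neither the letter before it nor the initial a. A second generator a' serves when the letter
  -- before it is a or its inverse.
  have hlast : ∀ w : List (α × Bool), ∃ c : α × Bool,
      (∀ x ∈ ((a, true) :: w).getLast?, x.1 = c.1 → x.2 = c.2) ∧ (c.1 = a → c.2 = true) := by
    intro w
    obtain ⟨x, hx⟩ : ∃ x, ((a, true) :: w).getLast? = some x :=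
      ⟨_, List.getLast?_eq_some_getLast (by simp)⟩
    by_cases h : x.1 = a
    · exact ⟨(a', true), by simp [hx, h, haa'], by simp [haa'.symm]⟩
    · exact ⟨(a, true), by simp [hx, h], by simp⟩
  choose c hc1 hc2 using hlast
  refine ⟨(reducedFrom (a, true) n).image fun w => (a, true) :: w ++ [c w], ?_, ?_⟩
  · intro w hw
    obtain ⟨v, hv, rfl⟩ := Finset.mem_image.1 hw
    obtain ⟨h1, h2⟩ := mem_reducedFrom.1 hv
    refine ⟨by simp [h1], isCyclicallyReduced_cons_append_iff.2 ⟨?_, hc2 v⟩⟩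
    unfold FreeGroup.IsReduced
    rw [List.isChain_append]
    exact ⟨h2, List.isChain_singleton _, by simpa using hc1 v⟩
  · rw [Finset.card_image_of_injective, card_reducedFrom]
    intro v v' h
    simp only [List.cons_append, List.cons.injEq, true_and] at h
    exact (List.append_inj' h rfl).1

variable [Nonempty α]

theorem card_le_exceptionalBound_of_injOn (hα : 2 ≤ Fintype.card α) {k p l : ℕ}
    (hkp : k + p ≤ l) (hp : (l : ℝ) / 16 ≤ p) {T : Finset (List (α × Bool))}
    (hT : T ⊆ reducedWords α l)
    (hinj : ∀ w ∈ T, ∀ w' ∈ T, w.take k = w'.take k → w.drop (k + p) = w'.drop (k + p) → w = w') :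
    (T.card : ℝ) ≤ exceptionalBound (Fintype.card α) l := by
  have hm : (2 : ℝ) ≤ Fintype.card α := by exact_mod_cast hα
  have h := card_le_of_injOn_take_drop (C := 1) (f := fun _ => 1) (g := fun _ => 1)
    (Nat.le_add_right k p) hkp hT hinj (by simp) (by simp)
    (M := 2 * (Fintype.card α : ℝ) - 1) (N := 2 * (Fintype.card α : ℝ) - 1) (by linarith)
    (by linarith) sum_one_sub_le sum_one_sub_le (by simp)
  rw [mul_one, ← pow_add, show k + (l - (k + p)) = l - p by omega] at h
  refine h.trans ?_
  unfold exceptionalBound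
  gcongr
  exact pow_sub_le_exp_mul_pow (by linarith) hp (by omega)

/-- Chernoff bound for the lower tail: each a or its inverse in the prefix has weight 1/e, so the
words counted have weight at least exp(-p/(8m)), while the row sum drops by 1 - 1/e. -/
theorem card_occurrences_take_le (hα : 2 ≤ Fintype.card α) {p l : ℕ} (hpl : p ≤ l)
    (hp : (l : ℝ) / 16 ≤ p) (a : α) {T : Finset (List (α × Bool))} (hT : T ⊆ reducedWords α l)
    (h : ∀ w ∈ T, (occurrences a (w.take p) : ℝ) ≤ 1 / (8 * (Fintype.card α : ℝ)) * p) :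
    (T.card : ℝ) ≤ exceptionalBound (Fintype.card α) l := by
  have hm : (2 : ℝ) ≤ Fintype.card α := by exact_mod_cast hα
  obtain ⟨m, hmm⟩ : ∃ m : ℝ, m = Fintype.card α := ⟨_, rfl⟩
  obtain ⟨x, hx⟩ : ∃ x : ℝ, x = Real.exp (-1) := ⟨_, rfl⟩
  have hx0 : 0 < x := hx ▸ Real.exp_pos _
  have hx1 : x ≤ 0.37 := by
    rw [hx]
    have := Real.exp_neg_one_lt_d9
    linarith
  have key := card_le_of_injOn_take_drop (C := Real.exp (-(1 / (8 * m) * p)))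
    (f := fun c => if c.1 = a then x else 1) (g := fun _ => 1) le_rfl hpl hT
    (fun w _ w' _ h1 h2 => by rw [← List.take_append_drop p w, h1, h2, List.take_append_drop])
    (fun c => by split_ifs <;> linarith) (by simp)
    (M := 2 * m - 1 + -(1 - x)) (N := 2 * m - 1) (by linarith)
    (by linarith) (fun b => by
      have := sum_ite_fst_sub_le_of_le_one a (x := x) (by linarith) b
      rw [hmm]; linarith) (hmm ▸ sum_one_sub_le) ?_
  · have hK : 0 < 2 * m - 1 := by linarith
    have h1 := pow_le_exp_mul_pow hK (y := -(1 - x)) (by linarith) p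
    rw [← hmm] at key
    have h2 : (T.card : ℝ) = T.card * Real.exp (-(1 / (8 * m) * p)) * Real.exp (1 / (8 * m) * p) := by
      rw [mul_assoc, ← Real.exp_add]
      simp
    have h3 : (2 * m - 1) ^ p * (2 * m - 1) ^ (l - p) = (2 * m - 1) ^ l := by
      rw [← pow_add, Nat.add_sub_cancel' hpl]
    -- With 1/(8m) ≤ 1/(4K) the rate per prefix letter is at most -(0.63 - 0.25)/K, and 0.38/16 >
    -- 1/60.
    have h4 : p * (-(1 - x) / (2 * m - 1)) + 1 / (8 * m) * p ≤ 1 + -(l / (60 * (2 * m - 1))) := by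
      have e1 : (1 : ℝ) / (8 * m) ≤ 1 / (4 * (2 * m - 1)) :=
        one_div_le_one_div_of_le (by linarith) (by linarith)
      have e2 : 1 / (8 * m) * p ≤ 1 / (4 * (2 * m - 1)) * p := by gcongr
      have e3 : p * (-(1 - x) / (2 * m - 1)) + 1 / (4 * (2 * m - 1)) * p
          + l / (60 * (2 * m - 1)) = (-(1 - x) * p + p / 4 + l / 60) / (2 * m - 1) := by
        field_simp
      have e4 : (-(1 - x) * p + p / 4 + l / 60) / (2 * m - 1) ≤ 0 :=
        div_nonpos_of_nonpos_of_nonneg (by nlinarith) hK.le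
      linarith
    calc (T.card : ℝ) ≤ (2 * m) ^ 2 * ((2 * m - 1 + -(1 - x)) ^ p * (2 * m - 1) ^ (l - p)) *
          Real.exp (1 / (8 * m) * p) := by rw [h2]; gcongr
      _ ≤ (2 * m) ^ 2 * ((Real.exp (p * (-(1 - x) / (2 * m - 1))) * (2 * m - 1) ^ p) *
          (2 * m - 1) ^ (l - p)) * Real.exp (1 / (8 * m) * p) := by gcongr
      _ = (2 * m) ^ 2 * (Real.exp (p * (-(1 - x) / (2 * m - 1)) + 1 / (8 * m) * p) *
          (2 * m - 1) ^ l) := by rw [Real.exp_add, ← h3]; ring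
      _ ≤ (2 * m) ^ 2 * (Real.exp (1 + -(l / (60 * (2 * m - 1)))) * (2 * m - 1) ^ l) := by gcongr
      _ = _ := by rw [exceptionalBound, Real.exp_add, hmm]
  · intro w hw
    rw [prod_map_ite_eq_pow_occurrences, hx, ← Real.exp_nat_mul]
    simp only [List.map_const', List.prod_replicate, one_pow, mul_one]
    have := h w hw
    rw [← hmm] at this
    gcongr
    linarith

/-- Weight 6/5 on the prefix and 5/6 on the suffix gives every counted word weight at least 1. The
prefix is only about a quarter of the word, so the loss on the suffix outweighs the gain on the
prefix. -/
theorem card_occurrences_drop_le (hα : 2 ≤ Fintype.card α) {q l : ℕ} (hql : q ≤ l)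
    (hq : (q : ℝ) ≤ l / 4 + 1) (a : α) {T : Finset (List (α × Bool))} (hT : T ⊆ reducedWords α l)
    (h : ∀ w ∈ T, occurrences a (w.drop q) ≤ occurrences a (w.take q)) :
    (T.card : ℝ) ≤ exceptionalBound (Fintype.card α) l := by
  have hm : (2 : ℝ) ≤ Fintype.card α := by exact_mod_cast hα
  obtain ⟨m, hmm⟩ : ∃ m : ℝ, m = Fintype.card α := ⟨_, rfl⟩
  have key := card_le_of_injOn_take_drop (C := 1)
    (f := fun c => if c.1 = a then 6 / 5 else 1) (g := fun c => if c.1 = a then 5 / 6 else 1)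
    le_rfl hql hT
    (fun w _ w' _ h1 h2 => by rw [← List.take_append_drop q w, h1, h2, List.take_append_drop])
    (fun c => by split_ifs <;> norm_num)
    (fun c => by split_ifs <;> norm_num)
    (M := 2 * m - 1 + 2 / 5) (N := 2 * m - 1 + -(1 / 6)) (by linarith)
    (by linarith) (fun b => by
      have := sum_ite_fst_sub_le_of_one_le a (x := 6 / 5) (by norm_num) b
      rw [hmm]; linarith) (fun b => by
      have := sum_ite_fst_sub_le_of_le_one a (x := 5 / 6) (by norm_num) b
      rw [hmm]; linarith) ?_
  · have hK : 0 < 2 * m - 1 := by linarith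
    have h1 := pow_le_exp_mul_pow hK (y := 2 / 5) (by linarith) q
    have h2 := pow_le_exp_mul_pow hK (y := -(1 / 6)) (by linarith) (l - q)
    rw [← hmm, mul_one] at key
    have h3 : (2 * m - 1) ^ q * (2 * m - 1) ^ (l - q) = (2 * m - 1) ^ l := by
      rw [← pow_add, Nat.add_sub_cancel' hql]
    -- At q = l/4 the rate is l/10 - l/8 = -l/40, below -l/60. The extra 1 allowed in q is absorbed
    -- by the factor e of `exceptionalBound`.
    have h4 : q * (2 / 5 / (2 * m - 1)) + ((l - q : ℕ) : ℝ) * (-(1 / 6) / (2 * m - 1)) ≤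
        1 + -(l / (60 * (2 * m - 1))) := by
      rw [Nat.cast_sub hql]
      have e3 : q * (2 / 5 / (2 * m - 1)) + ((l : ℝ) - q) * (-(1 / 6) / (2 * m - 1))
          + l / (60 * (2 * m - 1)) = (q * (2 / 5) - (l - q) / 6 + l / 60) / (2 * m - 1) := by
        field_simp
        ring
      have e4 : (q * (2 / 5) - (l - q) / 6 + l / 60) / (2 * m - 1) ≤ 1 := by
        rw [div_le_one hK]
        nlinarith
      linarith
    calc (T.card : ℝ) ≤ _ := key
      _ ≤ (2 * m) ^ 2 * ((Real.exp (q * (2 / 5 / (2 * m - 1))) * (2 * m - 1) ^ q) *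
          (Real.exp (((l - q : ℕ) : ℝ) * (-(1 / 6) / (2 * m - 1))) * (2 * m - 1) ^ (l - q))) := by
          have : 0 ≤ 2 * m - 1 + -(1 / 6) := by linarith
          gcongr
      _ = (2 * m) ^ 2 * (Real.exp (q * (2 / 5 / (2 * m - 1)) +
          ((l - q : ℕ) : ℝ) * (-(1 / 6) / (2 * m - 1))) * (2 * m - 1) ^ l) := by
          rw [Real.exp_add, ← h3]; ring
      _ ≤ (2 * m) ^ 2 * (Real.exp (1 + -(l / (60 * (2 * m - 1)))) * (2 * m - 1) ^ l) := by gcongr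
      _ = _ := by rw [exceptionalBound, Real.exp_add, hmm]
  · intro w hw
    rw [prod_map_ite_eq_pow_occurrences, prod_map_ite_eq_pow_occurrences]
    calc (1 : ℝ) = (6 / 5) ^ occurrences a (w.take q) * (5 / 6) ^ occurrences a (w.take q) := by
          rw [← mul_pow]; norm_num
      _ ≤ _ := by
          gcongr ?_ * ?_
          exact pow_le_pow_of_le_one (by norm_num) (by norm_num) (h w hw)

end WordBounds

/-! ### Probabilities for one and two random words -/

section RandomWords

open FreeGroup

namespace CycRedWord

variable {m l : ℕ}

/-- The letters of a cyclically reduced word. -/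
def word (x : CycRedWord m l) : List (Fin m × Bool) := x.1.toWord

theorem length_word (x : CycRedWord m l) : x.word.length = l := x.2.1

theorem isCyclicallyReduced_word (x : CycRedWord m l) : IsCyclicallyReduced x.word := x.2.2

theorem word_injective : Function.Injective (word : CycRedWord m l → List (Fin m × Bool)) :=
  fun _ _ h => Subtype.ext (toWord_injective h)

theorem exists_word_eq {w : List (Fin m × Bool)} (hw : IsCyclicallyReduced w)
    (hl : w.length = l) : ∃ x : CycRedWord m l, x.word = w := by
  have : (mk w).toWord = w := by rw [toWord_mk, hw.1.reduce_eq]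
  exact ⟨⟨mk w, by rw [this]; exact ⟨hl, hw⟩⟩, this⟩

theorem exists_word_dihedral (e : Bool) (k : ℕ) (x : CycRedWord m l) :
    ∃ y : CycRedWord m l, y.word = (if e then invRev x.word else x.word).rotate k := by
  refine exists_word_eq (IsCyclicallyReduced.rotate ?_ k) ?_
  · split_ifs
    · exact x.isCyclicallyReduced_word.invRev
    · exact x.isCyclicallyReduced_word
  · split_ifs <;> simp [length_word]

/-- The rotation by `k` of the word or, if `e` holds, of its inverse. -/
noncomputable def dihedral (e : Bool) (k : ℕ) (x : CycRedWord m l) : CycRedWord m l :=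
  (exists_word_dihedral e k x).choose

theorem word_dihedral (e : Bool) (k : ℕ) (x : CycRedWord m l) :
    (dihedral e k x).word = (if e then invRev x.word else x.word).rotate k :=
  (exists_word_dihedral e k x).choose_spec

theorem dihedral_injective (e : Bool) (k : ℕ) :
    Function.Injective (dihedral e k : CycRedWord m l → CycRedWord m l) := by
  intro x y h
  have := congrArg word h
  rw [word_dihedral, word_dihedral] at this
  have := List.rotate_injective k this
  cases e
  · exact word_injective (by simpa using this)
  · exact word_injective (invRev_injective (by simpa using this))

instance : Finite (CycRedWord m l) :=
  have := (List.finite_length_eq (Fin m × Bool) l).to_subtype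
  Finite.of_injective
    (fun x => (⟨x.word, x.length_word⟩ : {w : List (Fin m × Bool) | w.length = l}))
    fun _ _ h => word_injective (congrArg Subtype.val h)

theorem nonempty (hm : 2 ≤ m) (hl : 2 ≤ l) : Nonempty (CycRedWord m l) := by
  obtain ⟨T, hT, hc⟩ := exists_card_cyclicallyReduced_ge (α := Fin m) (by simpa using hm) (l - 2)
  have hm' : (2 : ℝ) ≤ m := by exact_mod_cast hm
  have : 0 < T.card := by
    have : (0 : ℝ) < T.card := by
      rw [hc, Fintype.card_fin]
      exact pow_pos (by linarith) _
    exact_mod_cast this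
  obtain ⟨w, hw⟩ := Finset.card_pos.1 this
  obtain ⟨x, -⟩ := exists_word_eq (hT w hw).2 (l := l) (by rw [(hT w hw).1]; omega)
  exact ⟨x⟩

theorem pow_le_card (hm : 2 ≤ m) (hl : 2 ≤ l) :
    (2 * (m : ℝ) - 1) ^ (l - 2) ≤ Nat.card (CycRedWord m l) := by
  obtain ⟨T, hT, hc⟩ := exists_card_cyclicallyReduced_ge (α := Fin m) (by simpa using hm) (l - 2)
  rw [Fintype.card_fin] at hc
  rw [← hc]
  have h : (T : Set (List (Fin m × Bool))) ⊆ Set.range (word : CycRedWord m l → _) := by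
    intro w hw
    obtain ⟨x, hx⟩ := exists_word_eq (hT w hw).2 (l := l) (by rw [(hT w hw).1]; omega)
    exact ⟨x, hx⟩
  have h2 := Set.ncard_le_ncard h (Set.finite_range _)
  rw [Set.ncard_coe_finset, ← Set.image_univ, Set.ncard_image_of_injective _ word_injective,
    Set.ncard_univ] at h2
  exact_mod_cast h2

end CycRedWord

open CycRedWord

/-- The bound on the probability of an exceptional event for one random word. -/
noncomputable def errorBound (m l : ℕ) : ℝ :=
  (2 * (m : ℝ)) ^ 2 * (2 * (m : ℝ) - 1) ^ 2 * Real.exp 1 *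
    Real.exp (-(l / (60 * (2 * (m : ℝ) - 1))))

/-- The factor K² in `errorBound` pays for the lower bound K^(l-2), instead of K^l, on the number of
cyclically reduced words. -/
theorem exceptionalBound_eq {m l : ℕ} (hl : 2 ≤ l) :
    exceptionalBound m l = errorBound m l * (2 * (m : ℝ) - 1) ^ (l - 2) := by
  obtain ⟨n, rfl⟩ := Nat.exists_eq_add_of_le' hl
  rw [exceptionalBound, errorBound, pow_add, Nat.add_sub_cancel]
  ring

variable {m l : ℕ}

theorem uniformOn_univ_eq (E : Set (CycRedWord m l)) :
    (uniformOn Set.univ E : ENNReal) = E.ncard / Nat.card (CycRedWord m l) := by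
  have := Fintype.ofFinite (CycRedWord m l)
  rw [uniformOn_univ, Measure.count_apply (MeasurableSet.of_discrete),
    ← Set.Finite.cast_ncard_eq (Set.toFinite E), Nat.card_eq_fintype_card]
  rfl

/-- Applied to `dihedral`, this reduces events about rotated or inverted words to events about the
word itself. -/
theorem uniformOn_univ_preimage_le {f : CycRedWord m l → CycRedWord m l}
    (hf : Function.Injective f) (E : Set (CycRedWord m l)) :
    (uniformOn Set.univ (f ⁻¹' E) : ENNReal) ≤ uniformOn Set.univ E := by
  have h := Set.ncard_le_ncard (Set.image_preimage_subset f E)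
  rw [Set.ncard_image_of_injective _ hf] at h
  rw [uniformOn_univ_eq, uniformOn_univ_eq]
  gcongr

theorem uniformOn_univ_le_errorBound (hm : 2 ≤ m) (hl : 2 ≤ l) {P : List (Fin m × Bool) → Prop}
    (hP : ∀ T ⊆ reducedWords (Fin m) l, (∀ w ∈ T, P w) →
      (T.card : ℝ) ≤ exceptionalBound (Fintype.card (Fin m)) l) :
    (uniformOn Set.univ {x : CycRedWord m l | P x.word} : ENNReal) ≤
      ENNReal.ofReal (errorBound m l) := by
  classical
  have : Nonempty (Fin m) := ⟨⟨0, by omega⟩⟩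
  have hm' : (2 : ℝ) ≤ m := by exact_mod_cast hm
  have hK : 0 < (2 * (m : ℝ) - 1) ^ (l - 2) := pow_pos (by linarith) _
  have h1 := hP ((reducedWords (Fin m) l).filter P) (Finset.filter_subset _ _)
    fun w hw => (Finset.mem_filter.1 hw).2
  rw [Fintype.card_fin, exceptionalBound_eq hl] at h1
  have h2 : {x : CycRedWord m l | P x.word}.ncard ≤ ((reducedWords (Fin m) l).filter P).card := by
    rw [← Set.ncard_image_of_injective _ word_injective, ← Set.ncard_coe_finset]
    refine Set.ncard_le_ncard ?_ (Finset.finite_toSet _)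
    rintro _ ⟨x, hx, rfl⟩
    exact Finset.mem_filter.2
      ⟨mem_reducedWords.2 ⟨x.length_word, x.isCyclicallyReduced_word.1⟩, hx⟩
  have h3 := pow_le_card hm hl
  have he : 0 ≤ errorBound m l := by unfold errorBound; positivity
  have hc : (0 : ℝ) < Nat.card (CycRedWord m l) := hK.trans_le h3
  rw [uniformOn_univ_eq, ← ENNReal.ofReal_natCast, ← ENNReal.ofReal_natCast,
    ← ENNReal.ofReal_div_of_pos hc]
  refine ENNReal.ofReal_le_ofReal ?_
  rw [div_le_iff₀ hc]
  calc (_ : ℝ) ≤ ((reducedWords (Fin m) l).filter P).card := by exact_mod_cast h2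
    _ ≤ _ := h1
    _ ≤ _ := by gcongr

theorem measure_setOf_exists_le {Ω ι : Type*} [MeasurableSpace Ω] [Fintype ι] (μ : Measure Ω)
    {P : ι → Ω → Prop} {c : ENNReal} (h : ∀ i, μ {x | P i x} ≤ c) :
    μ {x | ∃ i, P i x} ≤ Fintype.card ι * c := by
  rw [Set.ofPred_exists]
  calc _ ≤ ∑ i, μ {x | P i x} := measure_iUnion_fintype_le μ _
    _ ≤ ∑ _i : ι, c := Finset.sum_le_sum fun i _ => h i
    _ = _ := by simp

theorem measure_setOf_or_le {Ω : Type*} [MeasurableSpace Ω] (μ : Measure Ω) {P Q : Ω → Prop}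
    {a b : ENNReal} (hP : μ {x | P x} ≤ a) (hQ : μ {x | Q x} ≤ b) :
    μ {x | P x ∨ Q x} ≤ a + b :=
  (measure_union_le _ _).trans (add_le_add hP hQ)

/-- The words of length `l` that are not evenly distributed, or that share a long prefix with a
rotation of themselves or of their inverse. Here `p` and `q` are the lengths of the relevant
subwords. -/
def IsExceptional (p q l : ℕ) (w : List (Fin m × Bool)) : Prop :=
  (∃ s, w.take p = List.replicate p s) ∨
  (∃ a, occurrences a (w.drop q) ≤ occurrences a (w.take q)) ∨
  (∃ a, (occurrences a (w.take p) : ℝ) ≤ 1 / (8 * (m : ℝ)) * p) ∨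
  (∃ k : Fin l, 0 < k.1 ∧ k.1 + p ≤ l ∧ w.take p = (w.rotate k).take p) ∨
  (∃ k : Fin l, w.take p = ((invRev w).rotate k).take p)

/-- A word with prescribed prefix is determined by its suffix. This serves both for powers of a
letter and for prefixes shared by two draws. -/
theorem uniformOn_take_eq_le (hm : 2 ≤ m) (hl : 2 ≤ l) {p : ℕ} (hpl : p ≤ l)
    (hp : (l : ℝ) / 16 ≤ p) (v : List (Fin m × Bool)) :
    (uniformOn Set.univ {x : CycRedWord m l | x.word.take p = v} : ENNReal) ≤
      ENNReal.ofReal (errorBound m l) := by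
  have : Nonempty (Fin m) := ⟨⟨0, by omega⟩⟩
  refine uniformOn_univ_le_errorBound hm hl (P := fun w => w.take p = v) fun T hT h => ?_
  refine card_le_exceptionalBound_of_injOn (by simpa using hm) (k := 0) (p := p) (by omega) hp hT ?_
  intro w hw w' hw' _ hd
  rw [zero_add] at hd
  rw [← List.take_append_drop p w, ← List.take_append_drop p w', h w hw, h w' hw', hd]

theorem uniformOn_isExceptional_le (hm : 2 ≤ m) (hl : 2 ≤ l) {p q : ℕ} (hpl : p ≤ l)
    (hp : (l : ℝ) / 16 ≤ p) (hql : q ≤ l) (hq : (q : ℝ) ≤ l / 4 + 1) :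
    (uniformOn Set.univ {x : CycRedWord m l | IsExceptional p q l x.word} : ENNReal) ≤
      ((4 * m + 2 * l : ℕ) : ENNReal) * ENNReal.ofReal (errorBound m l) := by
  have : Nonempty (Fin m) := ⟨⟨0, by omega⟩⟩
  have hα : 2 ≤ Fintype.card (Fin m) := by simpa using hm
  have h1 := measure_setOf_exists_le (uniformOn Set.univ) fun s : Fin m × Bool =>
    uniformOn_take_eq_le hm hl hpl hp (List.replicate p s)
  have h2 := measure_setOf_exists_le (uniformOn Set.univ) fun a : Fin m =>
    uniformOn_univ_le_errorBound hm hl fun T hT h => card_occurrences_drop_le hα hql hq a hT h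
  have h3 := measure_setOf_exists_le (uniformOn Set.univ) fun a : Fin m =>
    uniformOn_univ_le_errorBound hm hl fun T hT h => card_occurrences_take_le hα hpl hp a hT h
  have h4 := measure_setOf_exists_le (uniformOn Set.univ) fun k : Fin l =>
    uniformOn_univ_le_errorBound hm hl
      (P := fun w => 0 < k.1 ∧ k.1 + p ≤ l ∧ w.take p = (w.rotate k).take p) fun T hT h => by
      -- The inequalities on k are part of the event, so a word of T is needed to extract them.
      rcases T.eq_empty_or_nonempty with rfl | ⟨w₀, hw₀⟩
      · simp only [Finset.card_empty, Nat.cast_zero]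
        unfold exceptionalBound
        have : (2 : ℝ) ≤ Fintype.card (Fin m) := by exact_mod_cast hα
        have : 0 ≤ 2 * (Fintype.card (Fin m) : ℝ) - 1 := by linarith
        positivity
      obtain ⟨hk, hkp, -⟩ := h w₀ hw₀
      refine card_le_exceptionalBound_of_injOn hα hkp hp hT fun w hw w' hw' ht hd => ?_
      have e := (mem_reducedWords.1 (hT hw)).1
      have e' := (mem_reducedWords.1 (hT hw')).1
      exact eq_of_take_eq_take_rotate hk (by omega) (by omega) (h w hw).2.2 (h w' hw').2.2 ht hd
  have h5 := measure_setOf_exists_le (uniformOn Set.univ) fun k : Fin l =>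
    uniformOn_univ_le_errorBound hm hl
      (P := fun w => w.take p = ((invRev w).rotate k).take p) fun T hT h => by
      rcases T.eq_empty_or_nonempty with rfl | ⟨w₀, hw₀⟩
      · simp only [Finset.card_empty, Nat.cast_zero]
        unfold exceptionalBound
        have : (2 : ℝ) ≤ Fintype.card (Fin m) := by exact_mod_cast hα
        have : 0 ≤ 2 * (Fintype.card (Fin m) : ℝ) - 1 := by linarith
        positivity
      have hk := k.2
      obtain ⟨hl₀, hr₀⟩ := mem_reducedWords.1 (hT hw₀)
      have h2p := two_mul_le_of_take_eq_take_rotate_invRev hr₀ (by omega) (by omega) (h w₀ hw₀)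
      refine card_le_exceptionalBound_of_injOn hα (k := l - k - p) (by omega) hp hT
        fun w hw w' hw' ht hd => ?_
      obtain ⟨e, hr⟩ := mem_reducedWords.1 (hT hw)
      have e' := (mem_reducedWords.1 (hT hw')).1
      rw [show l - k - p + p = l - k by omega] at hd
      exact eq_of_take_eq_take_rotate_invRev hr (by omega) (by omega) (by omega) (h w hw)
        (h w' hw') (by rwa [e]) (by rwa [e])
  have := measure_setOf_or_le _ h1 (measure_setOf_or_le _ h2 (measure_setOf_or_le _ h3
    (measure_setOf_or_le _ h4 h5)))
  simp only [Fintype.card_fin] at this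
  unfold IsExceptional
  refine this.trans (le_of_eq ?_)
  simp only [Fintype.card_prod, Fintype.card_fin, Fintype.card_bool, ← add_mul]
  push_cast
  ring

/-- Condition on the value y of the j-th coordinate: by independence the probability is at most an
average over y of quantities bounded by c. -/
theorem measure_pi_pair_le {X ι : Type*} [Fintype ι] [Finite X] [MeasurableSpace X]
    [DiscreteMeasurableSpace X] (μ : Measure X) [IsProbabilityMeasure μ] {i j : ι} (hij : i ≠ j)
    {T : X → X → Prop} {c : ENNReal} (h : ∀ y, μ {x | T x y} ≤ c) :
    Measure.pi (fun _ : ι => μ) {ω | T (ω i) (ω j)} ≤ c := by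
  classical
  have := Fintype.ofFinite X
  have hsub : {ω : ι → X | T (ω i) (ω j)} ⊆ ⋃ y, (({i, j} : Finset ι) : Set ι).pi
      fun k => if k = i then {x | T x y} else {y} := by
    intro ω hω
    simp only [Set.mem_iUnion]
    refine ⟨ω j, fun k hk => ?_⟩
    simp only [Finset.coe_insert, Finset.coe_singleton, Set.mem_insert_iff,
      Set.mem_singleton_iff] at hk
    rcases hk with rfl | rfl
    · simpa using hω
    · simp [hij.symm]
  calc _ ≤ ∑ y, Measure.pi (fun _ : ι => μ) ((({i, j} : Finset ι) : Set ι).pi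
      fun k => if k = i then {x | T x y} else {y}) :=
        (measure_mono hsub).trans (measure_iUnion_fintype_le _ _)
    _ = ∑ y, μ {x | T x y} * μ {y} := by
        refine Finset.sum_congr rfl fun y _ => ?_
        rw [Measure.pi_pi_finset, Finset.prod_pair hij]
        simp [hij.symm]
    _ ≤ ∑ y, c * μ {y} := by gcongr with y; exact h y
    _ = c := by
        rw [← Finset.mul_sum, sum_measure_singleton]
        simp

end RandomWords

/-! ### The symmetrization of a set of relators -/

section Symmetrization

open FreeGroup

variable {α : Type*} [DecidableEq α] {R : Set (FreeGroup α)}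

theorem List.IsRotated.exists_lt_rotate_eq {β : Type*} {v w : List β} (h : v ~r w)
    (hv : 0 < v.length) : ∃ k < v.length, v.rotate k = w := by
  obtain ⟨n, rfl⟩ := h
  exact ⟨n % v.length, Nat.mod_lt _ hv, List.rotate_mod v n⟩

theorem invRev_ite {β : Type*} (e : Bool) (w : List (β × Bool)) :
    invRev (if e then invRev w else w) = if !e then invRev w else w := by
  cases e <;> simp

/-- Cyclic reducedness prevents cancellation in rotated words, and inversion carries rotations to
rotations, so at most one inversion and one rotation are needed. -/
theorem Symmetrization.exists_isRotated (hR : CyclicallyReducedRelators R) {g : FreeGroup α}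
    (hg : Symmetrization R g) :
    ∃ r ∈ R, ∃ e : Bool, (if e then invRev r.toWord else r.toWord) ~r g.toWord := by
  have hcyc : ∀ r ∈ R, ∀ e : Bool,
      IsCyclicallyReduced (if e then invRev r.toWord else r.toWord) := by
    intro r hr e
    split_ifs
    · exact (hR r hr).invRev
    · exact hR r hr
  induction hg with
  | base r hr => exact ⟨r, hr, false, List.IsRotated.refl _⟩
  | rotate r n _ ih =>
    obtain ⟨s, hs, e, h⟩ := ih
    refine ⟨s, hs, e, ?_⟩
    rw [toWord_mk, (((hcyc s hs e).of_isRotated h).rotate n).1.reduce_eq]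
    exact h.trans ⟨n, rfl⟩
  | inv r _ ih =>
    obtain ⟨s, hs, e, h⟩ := ih
    refine ⟨s, hs, !e, ?_⟩
    rw [toWord_inv]
    have := invRev_isRotated h
    cases e <;> simpa using this

theorem cyclicallyReducedRelators_symmetrization (hR : CyclicallyReducedRelators R) :
    CyclicallyReducedRelators (symmetrization R) := by
  intro g hg
  obtain ⟨r, hr, e, h⟩ := Symmetrization.exists_isRotated hR hg
  refine IsCyclicallyReduced.of_isRotated ?_ h
  split_ifs
  · exact (hR r hr).invRev
  · exact hR r hr

theorem isSymmetrized_symmetrization (R : Set (FreeGroup α)) :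
    IsSymmetrized (symmetrization R) :=
  fun r hr => ⟨Symmetrization.inv r hr, fun n => Symmetrization.rotate r n hr⟩

/-- A rotation turns uv into its conjugate vu. -/
theorem normalClosure_symmetrization (R : Set (FreeGroup α)) :
    Subgroup.normalClosure (symmetrization R) = Subgroup.normalClosure R := by
  refine le_antisymm (Subgroup.normalClosure_le_normal ?_)
    (Subgroup.normalClosure_mono fun r hr => Symmetrization.base r hr)
  intro g (hg : Symmetrization R g)
  induction hg with
  | base r hr => exact Subgroup.subset_normalClosure hr
  | rotate r n _ ih =>
    rw [SetLike.mem_coe] at ih ⊢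
    rw [List.rotate_eq_drop_append_take_mod, ← mul_mk]
    refine (Subgroup.normalClosure_normal (s := R)).mem_comm ?_
    rwa [mul_mk, List.take_append_drop, mk_toWord]
  | inv r _ ih => exact inv_mem ih

end Symmetrization

/-! ### From absence of bad events to a translation-apparent presentation -/

section Deterministic

open FreeGroup CycRedWord

variable {m l N : ℕ}

theorem cyclicallyReducedRelators_relatorSet (ω : Fin N → CycRedWord m l) :
    CyclicallyReducedRelators (relatorSet ω) := by
  rintro _ ⟨i, rfl⟩
  exact (ω i).2.2

theorem exists_toWord_eq_dihedral (hl : 0 < l) (ω : Fin N → CycRedWord m l)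
    {g : FreeGroup (Fin m)} (hg : g ∈ symmetrization (relatorSet ω)) :
    ∃ (i : Fin N) (e : Bool) (k : Fin l), (dihedral e k (ω i)).word = g.toWord := by
  obtain ⟨_, ⟨i, rfl⟩, e, h⟩ :=
    Symmetrization.exists_isRotated (cyclicallyReducedRelators_relatorSet ω) hg
  dsimp only at h
  have hlen : (if e then invRev (ω i).1.toWord else (ω i).1.toWord).length = l := by
    split_ifs <;> simp [(ω i).2.1]
  obtain ⟨k, hk, hkw⟩ := h.exists_lt_rotate_eq (by omega)
  exact ⟨i, e, ⟨k, by omega⟩, by rw [word_dihedral]; exact hkw⟩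

theorem length_toWord_of_mem_symmetrization (hl : 0 < l) (ω : Fin N → CycRedWord m l)
    {g : FreeGroup (Fin m)} (hg : g ∈ symmetrization (relatorSet ω)) : g.toWord.length = l := by
  obtain ⟨i, e, k, h⟩ := exists_toWord_eq_dihedral hl ω hg
  rw [← h, length_word]

theorem isFinitePresentation_symmetrization (hl : 0 < l) (ω : Fin N → CycRedWord m l) :
    IsFinitePresentation (relatorGroupGen ω) (symmetrization (relatorSet ω)) := by
  have hlift : FreeGroup.lift (relatorGroupGen ω) = PresentedGroup.mk (relatorSet ω) := by
    ext a
    simp [relatorGroupGen, PresentedGroup.of]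
  refine ⟨inferInstance, ?_, ?_, ?_⟩
  · refine Set.Finite.subset ((List.finite_length_eq (Fin m × Bool) l).preimage
      (toWord_injective.injOn)) ?_
    exact fun g hg => length_toWord_of_mem_symmetrization hl ω hg
  · rw [hlift]
    exact PresentedGroup.mk_surjective _
  · rw [normalClosure_symmetrization, hlift]
    ext x
    rw [MonoidHom.mem_ker, PresentedGroup.mk_eq_one_iff]

/-- Any violation can be rotated to a prefix. A piece that is too long gives two relators with a
common prefix of length p: if they come from different draws, `h2` excludes it; if from the same
draw, one is a rotation of the other or of its inverse, and `h1` applies. -/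
theorem isTranslationApparent_of_forall_not_isExceptional (hl : 2 ≤ l)
    (ω : Fin N → CycRedWord m l) {p q : ℕ} (hp : p = ⌈(1 / 16 : ℝ) * l⌉₊)
    (hq : q = ⌈4 * (1 / 16 : ℝ) * l⌉₊)
    (h1 : ∀ i e (k : Fin l), ¬ IsExceptional p q l (dihedral e k (ω i)).word)
    (h2 : ∀ i j, i ≠ j → ∀ e (k : Fin l) e' (k' : Fin l),
      (dihedral e k (ω i)).word.take p ≠ (dihedral e' k' (ω j)).word.take p) :
    IsTranslationApparent (1 / 16) (relatorGroupMarking ω) (relatorGroupGen ω)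
      (symmetrization (relatorSet ω)) := by
  have hl0 : 0 < l := by omega
  have hlen := fun g (hg : g ∈ symmetrization (relatorSet ω)) =>
    length_toWord_of_mem_symmetrization hl0 ω hg
  have hcyc := cyclicallyReducedRelators_symmetrization (cyclicallyReducedRelators_relatorSet ω)
  have h2p : 2 * p ≤ l := by
    have hp' : p ≤ (l + 15) / 16 := by
      rw [hp, Nat.ceil_le]
      have : l ≤ 16 * ((l + 15) / 16) := by omega
      have : (l : ℝ) ≤ 16 * ((l + 15) / 16 : ℕ) := by exact_mod_cast this
      linarith
    omega
  have hrot : ∀ g ∈ symmetrization (relatorSet ω), ∀ v, g.toWord ~r v →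
      ¬ IsExceptional p q l v := by
    rintro g hg v ⟨n, rfl⟩
    obtain ⟨i, e, k, h⟩ := exists_toWord_eq_dihedral hl0 ω (Symmetrization.rotate g n hg)
    rw [toWord_mk, ((hcyc g hg).rotate n).1.reduce_eq] at h
    rw [← h]
    exact h1 i e k
  refine ⟨isFinitePresentation_symmetrization hl0 ω, rfl, isSymmetrized_symmetrization _, hcyc,
    ?_, ?_⟩
  · rintro w ⟨-, r₁, hr₁, r₂, hr₂, hne, hw₁, hw₂⟩ r hr -
    rw [hlen r hr]
    by_contra! hlt
    have hpw : p ≤ w.toWord.length := by rw [hp]; exact Nat.ceil_le.2 hlt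
    have htake : r₁.toWord.take p = r₂.toWord.take p := by
      obtain ⟨t₁, ht₁⟩ := hw₁
      obtain ⟨t₂, ht₂⟩ := hw₂
      rw [← ht₁, ← ht₂, List.take_append_of_le_length hpw, List.take_append_of_le_length hpw]
    obtain ⟨i, e, k, hi⟩ := exists_toWord_eq_dihedral hl0 ω hr₁
    obtain ⟨j, e', k', hj⟩ := exists_toWord_eq_dihedral hl0 ω hr₂
    rcases eq_or_ne i j with rfl | hij
    · have n₁ := hrot r₁ hr₁ _ (List.IsRotated.refl _)
      have n₂ := hrot r₂ hr₂ _ (List.IsRotated.refl _)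
      have l₁ := hlen r₁ hr₁
      have l₂ := hlen r₂ hr₂
      rw [word_dihedral] at hi hj
      by_cases hee : e = e'
      · subst hee
        have h12 : r₁.toWord ~r r₂.toWord :=
          (List.IsRotated.symm ⟨k, hi⟩).trans ⟨k', hj⟩
        obtain ⟨n, hn, hnr⟩ := h12.exists_lt_rotate_eq (by omega)
        have hn0 : 0 < n := by
          rcases Nat.eq_zero_or_pos n with rfl | h
          · rw [List.rotate_zero] at hnr
            exact absurd (toWord_injective hnr) hne
          · exact h
        by_cases hnp : n + p ≤ l
        · exact n₁ (Or.inr (Or.inr (Or.inr (Or.inl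
            ⟨⟨n, by omega⟩, hn0, hnp, by rw [htake, hnr]⟩))))
        -- If the shift n is too close to l, exchange the two relators: the shift becomes l - n, and
        -- l - n + p ≤ l since n > l - p ≥ p.
        · refine n₂ (Or.inr (Or.inr (Or.inr (Or.inl
            ⟨⟨l - n, by omega⟩, by dsimp only; omega, by dsimp only; omega, ?_⟩))))
          rw [← htake, ← hnr, List.rotate_rotate, show n + (l - n) = r₁.toWord.length by omega,
            List.rotate_length]
      · have h12 : invRev r₁.toWord ~r r₂.toWord := by
          refine List.IsRotated.trans (invRev_isRotated (List.IsRotated.symm ⟨k, hi⟩)) ?_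
          refine List.IsRotated.trans ?_ ⟨k', hj⟩
          obtain rfl : e' = !e := by
            cases e <;> cases e' <;> first | rfl | exact absurd rfl hee
          rw [invRev_ite]
        obtain ⟨n, hn, hnr⟩ := h12.exists_lt_rotate_eq (by rw [invRev_length]; omega)
        rw [invRev_length] at hn
        exact n₁ (Or.inr (Or.inr (Or.inr (Or.inr ⟨⟨n, by omega⟩, by rw [htake, hnr]⟩))))
    · exact h2 i j hij e k e' k' (by rw [hi, hj, htake])
  · intro r hr
    have hrl := hlen r hr
    refine ⟨?_, ?_, ?_⟩
    · intro s n hsn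
      rw [hrl]
      by_contra! hlt
      have hpn : p ≤ n := by rw [hp]; exact Nat.ceil_le.2 hlt
      obtain ⟨r', hr', ht⟩ := hsn.exists_isRotated_take
      refine hrot r hr r' hr' (Or.inl ⟨s, ?_⟩)
      rw [List.length_replicate] at ht
      have := congrArg (List.take p) ht
      rwa [List.take_take, min_eq_left hpn, List.take_replicate, min_eq_left hpn] at this
    · intro a u hu hul
      rw [hrl, ← hq] at hul
      obtain ⟨r', hr', ht⟩ := hu.exists_isRotated_take
      rw [hul] at ht
      -- Having less than half of the occurrences means having fewer than the complement, which is
      -- the suffix of the rotated relator.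
      have hn : ¬ occurrences a (r'.drop q) ≤ occurrences a (r'.take q) :=
        fun h => hrot r hr r' hr' (Or.inr (Or.inl ⟨a, h⟩))
      rw [ht] at hn
      have e : occurrences a r.toWord = occurrences a u + occurrences a (r'.drop q) := by
        rw [occurrences_eq_of_perm a hr'.perm, ← ht, ← occurrences_append, List.take_append_drop]
      have : occurrences a u + 1 ≤ occurrences a (r'.drop q) := by omega
      have : (occurrences a u : ℝ) + 1 ≤ occurrences a (r'.drop q) := by exact_mod_cast this
      rw [e]
      push_cast
      linarith
    · intro a u hu hul
      rw [hrl, ← hp] at hul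
      obtain ⟨r', hr', ht⟩ := hu.exists_isRotated_take
      rw [hul] at ht
      rw [hul, ← ht, Fintype.card_fin]
      by_contra! h
      exact hrot r hr r' hr' (Or.inr (Or.inr (Or.inl ⟨a, h⟩)))

end Deterministic

/-! ### Union bound and asymptotics -/

section Genericity

open FreeGroup CycRedWord

variable {m l : ℕ}

theorem isProbabilityMeasure_uniformOn_univ (hm : 2 ≤ m) (hl : 2 ≤ l) :
    IsProbabilityMeasure (uniformOn (Set.univ : Set (CycRedWord m l))) :=
  have := CycRedWord.nonempty hm hl
  isProbabilityMeasure_uniformOn Set.finite_univ Set.univ_nonempty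

theorem isProbabilityMeasure_relatorLaw (hm : 2 ≤ m) (hl : 2 ≤ l) (d : ℝ) :
    IsProbabilityMeasure (relatorLaw m d l) := by
  have := isProbabilityMeasure_uniformOn_univ hm hl
  unfold relatorLaw
  infer_instance

theorem relatorLaw_exists_isExceptional_le (hm : 2 ≤ m) (hl : 2 ≤ l) (d : ℝ) {p q : ℕ}
    (hpl : p ≤ l) (hp : (l : ℝ) / 16 ≤ p) (hql : q ≤ l) (hq : (q : ℝ) ≤ l / 4 + 1) :
    relatorLaw m d l {ω | ∃ z : Fin (numRelators m d l) × Bool × Fin l,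
      IsExceptional p q l (dihedral z.2.1 z.2.2 (ω z.1)).word} ≤
    ((numRelators m d l * (2 * l) * (4 * m + 2 * l) : ℕ) : ENNReal) *
      ENNReal.ofReal (errorBound m l) := by
  have := isProbabilityMeasure_uniformOn_univ hm hl
  refine (measure_setOf_exists_le _
    (c := ((4 * m + 2 * l : ℕ) : ENNReal) * ENNReal.ofReal (errorBound m l)) ?_).trans (le_of_eq ?_)
  · rintro ⟨i, e, k⟩
    have h1 := (measurePreserving_eval (fun _ : Fin (numRelators m d l) =>
      uniformOn (Set.univ : Set (CycRedWord m l))) i).measure_preimage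
      (s := dihedral e k ⁻¹' {x | IsExceptional p q l x.word})
      (MeasurableSet.of_discrete.nullMeasurableSet)
    refine (le_of_eq h1).trans ?_
    exact (uniformOn_univ_preimage_le (dihedral_injective e k) _).trans
      (uniformOn_isExceptional_le hm hl hpl hp hql hq)
  · simp only [Fintype.card_prod, Fintype.card_fin, Fintype.card_bool]
    push_cast
    ring

theorem relatorLaw_exists_take_eq_le (hm : 2 ≤ m) (hl : 2 ≤ l) (d : ℝ) {p : ℕ}
    (hpl : p ≤ l) (hp : (l : ℝ) / 16 ≤ p) :
    relatorLaw m d l {ω | ∃ z : (Fin (numRelators m d l) × Bool × Fin l) ×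
        (Fin (numRelators m d l) × Bool × Fin l), z.1.1 ≠ z.2.1 ∧
      (dihedral z.1.2.1 z.1.2.2 (ω z.1.1)).word.take p =
        (dihedral z.2.2.1 z.2.2.2 (ω z.2.1)).word.take p} ≤
    (((numRelators m d l * (2 * l)) ^ 2 : ℕ) : ENNReal) *
      ENNReal.ofReal (errorBound m l) := by
  have := isProbabilityMeasure_uniformOn_univ hm hl
  refine (measure_setOf_exists_le _ (c := ENNReal.ofReal (errorBound m l)) ?_).trans (le_of_eq ?_)
  · rintro ⟨⟨i, e, k⟩, ⟨j, e', k'⟩⟩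
    rcases eq_or_ne i j with rfl | hij
    · simp
    · simp only [ne_eq, hij, not_false_eq_true, true_and]
      refine measure_pi_pair_le (uniformOn Set.univ) hij
        (T := fun x y => (dihedral e k x).word.take p = (dihedral e' k' y).word.take p) fun y => ?_
      exact (uniformOn_univ_preimage_le (dihedral_injective e k)
        {x | x.word.take p = (dihedral e' k' y).word.take p}).trans
        (uniformOn_take_eq_le hm hl hpl hp _)
  · simp only [Fintype.card_prod, Fintype.card_fin, Fintype.card_bool]
    push_cast
    ring

theorem relatorLaw_not_isTranslationApparent_le (hm : 2 ≤ m) (hl : 2 ≤ l) (d : ℝ) :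
    relatorLaw m d l {ω | ¬ IsTranslationApparent (1 / 16) (relatorGroupMarking ω)
      (relatorGroupGen ω) (symmetrization (relatorSet ω))} ≤
    ENNReal.ofReal (16 * m * l ^ 2 * (numRelators m d l : ℝ) ^ 2 * errorBound m l) := by
  have hl0 : (0 : ℝ) ≤ l := Nat.cast_nonneg l
  obtain ⟨p, hp⟩ : ∃ p, p = ⌈(1 / 16 : ℝ) * l⌉₊ := ⟨_, rfl⟩
  obtain ⟨q, hq⟩ : ∃ q, q = ⌈4 * (1 / 16 : ℝ) * l⌉₊ := ⟨_, rfl⟩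
  have hpl : p ≤ l := by rw [hp, Nat.ceil_le]; linarith
  have hql : q ≤ l := by rw [hq, Nat.ceil_le]; linarith
  have hp' : (l : ℝ) / 16 ≤ p := by
    have := Nat.le_ceil ((1 / 16 : ℝ) * l)
    rw [← hp] at this
    linarith
  have hq' : (q : ℝ) ≤ l / 4 + 1 := by
    have := Nat.ceil_lt_add_one (a := 4 * (1 / 16 : ℝ) * l) (by positivity)
    rw [← hq] at this
    linarith
  have hbad := measure_setOf_or_le (relatorLaw m d l)
    (relatorLaw_exists_isExceptional_le hm hl d hpl hp' hql hq')
    (relatorLaw_exists_take_eq_le hm hl d hpl hp')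
  refine (measure_mono ?_).trans (hbad.trans ?_)
  · intro ω hω
    by_contra hgood
    refine hω (isTranslationApparent_of_forall_not_isExceptional hl ω hp hq ?_ ?_)
    · exact fun i e k h => hgood (Or.inl ⟨(i, e, k), h⟩)
    · exact fun i j hij e k e' k' h => hgood (Or.inr ⟨((i, e, k), (j, e', k')), hij, h⟩)
  · have he : 0 ≤ errorBound m l := by unfold errorBound; positivity
    rw [← add_mul, ← Nat.cast_add, ← ENNReal.ofReal_natCast,
      ← ENNReal.ofReal_mul (Nat.cast_nonneg _)]
    refine ENNReal.ofReal_le_ofReal (mul_le_mul_of_nonneg_right ?_ he)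
    have h : numRelators m d l * (2 * l) * (4 * m + 2 * l) + (numRelators m d l * (2 * l)) ^ 2 ≤
        16 * m * l ^ 2 * numRelators m d l ^ 2 := by
      generalize numRelators m d l = N
      -- The linear term for single draws is absorbed into the quadratic term for pairs.
      have h1 : N ≤ N ^ 2 := Nat.le_self_pow two_ne_zero N
      calc N * (2 * l) * (4 * m + 2 * l) + (N * (2 * l)) ^ 2
          ≤ N ^ 2 * (2 * l) * (4 * m + 2 * l) + (N * (2 * l)) ^ 2 := by gcongr
        _ = N ^ 2 * l * (8 * m + 8 * l) := by ring
        _ ≤ N ^ 2 * l * (16 * m * l) := by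
            gcongr
            nlinarith
        _ = _ := by ring
    exact_mod_cast h

theorem one_lt_log_of_two_le (hm : 2 ≤ m) : 1 < Real.log (2 * (m : ℝ) - 1) := by
  have hm' : (2 : ℝ) ≤ m := by exact_mod_cast hm
  rw [Real.lt_log_iff_exp_lt (by linarith)]
  have := Real.exp_one_lt_d9
  linarith

theorem chernoffConst_pos (hm : 2 ≤ m) : 0 < chernoffConst m := by
  have hm' : (2 : ℝ) ≤ m := by exact_mod_cast hm
  have h1 : 0 < (m : ℝ) - 1 := by linarith
  have h2 : 0 < 2 * (m : ℝ) - 1 := by linarith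
  unfold chernoffConst
  positivity

/-- Since 16 · 384 = 6144, the left side is at most 1/(6144 K²). This is all that is used of the
size of the constant, with much to spare. -/
theorem chernoffConst_div_le (hm : 2 ≤ m) :
    chernoffConst m / 16 ≤ 1 / (1000 * (2 * (m : ℝ) - 1)) := by
  have hm' : (2 : ℝ) ≤ m := by exact_mod_cast hm
  have h2 : 0 < 2 * (m : ℝ) - 1 := by linarith
  unfold chernoffConst
  rw [div_div, div_le_div_iff₀ (by positivity) (by positivity), one_mul]
  have h3 : ((m : ℝ) - 1) ^ 2 ≤ m ^ 2 := by nlinarith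
  calc ((m : ℝ) - 1) ^ 2 * (1000 * (2 * m - 1)) ≤ m ^ 2 * (6144 * (2 * m - 1) * (2 * m - 1)) := by
        gcongr ?_ * ?_
        nlinarith
    _ = _ := by ring

theorem densityBound_pos (hm : 2 ≤ m) : 0 < densityBound m := by
  have := one_lt_log_of_two_le hm
  have := chernoffConst_pos hm
  unfold densityBound
  positivity

theorem densityBound_lt_one (hm : 2 ≤ m) : densityBound m < 1 := by
  have hm' : (2 : ℝ) ≤ m := by exact_mod_cast hm
  have h1 := one_lt_log_of_two_le hm
  have h2 := chernoffConst_div_le hm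
  have h3 : 1 / (1000 * (2 * (m : ℝ) - 1)) ≤ 1 := by
    rw [div_le_one (by linarith)]
    linarith
  unfold densityBound
  rw [div_lt_one (by linarith)]
  linarith

theorem numRelators_le_exp (hm : 2 ≤ m) {d : ℝ} (hd : d < densityBound m) (l : ℕ) :
    (numRelators m d l : ℝ) ≤ Real.exp (l / (1000 * (2 * (m : ℝ) - 1))) := by
  have hm' : (2 : ℝ) ≤ m := by exact_mod_cast hm
  have hK : 0 < 2 * (m : ℝ) - 1 := by linarith
  have h1 := one_lt_log_of_two_le hm
  have h2 : d * Real.log (2 * (m : ℝ) - 1) ≤ 1 / (1000 * (2 * (m : ℝ) - 1)) := by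
    refine le_trans ?_ (chernoffConst_div_le hm)
    calc d * Real.log (2 * (m : ℝ) - 1) ≤ densityBound m * Real.log (2 * (m : ℝ) - 1) := by gcongr
      _ = _ := by unfold densityBound; field_simp
  calc (numRelators m d l : ℝ) ≤ (2 * (m : ℝ) - 1) ^ (d * (l : ℝ)) :=
        Nat.floor_le (Real.rpow_nonneg hK.le _)
    _ = Real.exp (d * Real.log (2 * (m : ℝ) - 1) * l) := by
        rw [Real.rpow_def_of_pos hK]
        congr 1
        ring
    _ ≤ Real.exp (1 / (1000 * (2 * (m : ℝ) - 1)) * l) := by gcongr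
    _ = _ := by rw [one_div_mul_eq_div]

theorem tendsto_sq_mul_exp_neg_mul {b : ℝ} (hb : 0 < b) :
    Tendsto (fun l : ℕ => (l : ℝ) ^ 2 * Real.exp (-(b * l))) atTop (𝓝 0) := by
  have h := (Real.tendsto_pow_mul_exp_neg_atTop_nhds_zero 2).comp
    (tendsto_natCast_atTop_atTop.const_mul_atTop hb)
  have h2 := h.const_mul (b ^ 2)⁻¹
  rw [mul_zero] at h2
  refine h2.congr fun l => ?_
  simp only [Function.comp_apply]
  field_simp

theorem tendsto_failureBound (hm : 2 ≤ m) {d : ℝ} (hd : d < densityBound m) :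
    Tendsto (fun l : ℕ => 16 * m * (l : ℝ) ^ 2 * (numRelators m d l : ℝ) ^ 2 * errorBound m l)
      atTop (𝓝 0) := by
  have hm' : (2 : ℝ) ≤ m := by exact_mod_cast hm
  have hK : 0 < 2 * (m : ℝ) - 1 := by linarith
  obtain ⟨C, hC⟩ : ∃ C : ℝ, C = (2 * (m : ℝ)) ^ 2 * (2 * (m : ℝ) - 1) ^ 2 * Real.exp 1 := ⟨_, rfl⟩
  have hC0 : 0 ≤ C := by rw [hC]; positivity
  have hb : 0 < 1 / (100 * (2 * (m : ℝ) - 1)) := by positivity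
  have hlim := (tendsto_sq_mul_exp_neg_mul hb).const_mul (16 * m * C)
  rw [mul_zero] at hlim
  refine squeeze_zero (fun l => ?_) (fun l => ?_) hlim
  · unfold errorBound
    positivity
  · have hl0 : (0 : ℝ) ≤ l := Nat.cast_nonneg l
    rw [errorBound, ← hC]
    calc _ ≤ 16 * m * (l : ℝ) ^ 2 * (Real.exp (l / (1000 * (2 * (m : ℝ) - 1)))) ^ 2 *
          (C * Real.exp (-(l / (60 * (2 * (m : ℝ) - 1))))) := by
          gcongr
          exact numRelators_le_exp hm hd l
      _ = 16 * m * C * ((l : ℝ) ^ 2 * Real.exp (2 * (l / (1000 * (2 * (m : ℝ) - 1))) +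
          -(l / (60 * (2 * (m : ℝ) - 1))))) := by
          rw [Real.exp_add, ← Real.exp_nat_mul]
          push_cast
          ring
      _ ≤ _ := by
          gcongr
          -- The square of the number of relators costs 2/1000 against the gain 1/60; the decay rate
          -- 1/100 fits in between, as 2/1000 - 1/60 + 1/100 = -7/1500.
          have e : 2 * (l / (1000 * (2 * (m : ℝ) - 1))) + -(l / (60 * (2 * (m : ℝ) - 1))) +
              1 / (100 * (2 * (m : ℝ) - 1)) * l = -(7 / 1500) * l / (2 * (m : ℝ) - 1) := by
            field_simp
            ring
          have : -(7 / 1500) * l / (2 * (m : ℝ) - 1) ≤ 0 :=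
            div_nonpos_of_nonpos_of_nonneg (by linarith) hK.le
          linarith

theorem tendsto_relatorLaw_isTranslationApparent (hm : 2 ≤ m) {d : ℝ} (hd : d < densityBound m) :
    Tendsto (fun l : ℕ => relatorLaw m d l
      {ω | IsTranslationApparent (1 / 16) (relatorGroupMarking ω) (relatorGroupGen ω)
        (symmetrization (relatorSet ω))}) atTop (𝓝 1) := by
  have h1 := (ENNReal.continuous_ofReal.tendsto 0).comp (tendsto_failureBound hm hd)
  have h2 := ENNReal.Tendsto.sub (tendsto_const_nhds (x := (1 : ENNReal))) h1
    (Or.inl ENNReal.one_ne_top)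
  rw [ENNReal.ofReal_zero, tsub_zero] at h2
  refine tendsto_of_tendsto_of_tendsto_of_le_of_le' h2 tendsto_const_nhds ?_ ?_
  · filter_upwards [eventually_ge_atTop 2] with l hl
    have := isProbabilityMeasure_relatorLaw hm hl d
    rw [tsub_le_iff_right]
    -- Subadditivity over the event and its complement suffices, so no measurability is needed.
    calc (1 : ENNReal) = relatorLaw m d l Set.univ := measure_univ.symm
      _ ≤ relatorLaw m d l ({ω | IsTranslationApparent (1 / 16) (relatorGroupMarking ω)
            (relatorGroupGen ω) (symmetrization (relatorSet ω))} ∪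
            {ω | ¬ IsTranslationApparent (1 / 16) (relatorGroupMarking ω)
            (relatorGroupGen ω) (symmetrization (relatorSet ω))}) :=
          measure_mono fun ω _ => em _
      _ ≤ _ := measure_union_le _ _
      _ ≤ _ := by
          gcongr
          exact relatorLaw_not_isTranslationApparent_le hm hl d
  · filter_upwards [eventually_ge_atTop 2] with l hl
    have := isProbabilityMeasure_relatorLaw hm hl d
    exact prob_le_one

end Genericity

theorem theoremB (m : ℕ) (hm : 2 ≤ m) :
    0 < densityBound m ∧ densityBound m < 1 ∧
    ∀ d : ℝ, 0 ≤ d → d < densityBound m →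
      Tendsto (fun l : ℕ => relatorLaw m d l
          {ω | AdmitsTranslationApparent (1 / 16) (relatorGroupMarking ω)})
        atTop (𝓝 1) ∧
      Tendsto (fun l : ℕ => relatorLaw m d l
          {ω | IsTranslationApparent (1 / 16) (relatorGroupMarking ω) (relatorGroupGen ω)
            (symmetrization (relatorSet ω))})
        atTop (𝓝 1) := by
  refine ⟨densityBound_pos hm, densityBound_lt_one hm, fun d _ hd => ?_⟩
  have h := tendsto_relatorLaw_isTranslationApparent hm hd
  refine ⟨tendsto_of_tendsto_of_tendsto_of_le_of_le' h tendsto_const_nhds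
    (Eventually.of_forall fun l => measure_mono fun ω hω => ⟨m, _, _, hω⟩) ?_, h⟩
  filter_upwards [eventually_ge_atTop 2] with l hl
  have := isProbabilityMeasure_relatorLaw hm hl d
  exact prob_le_one
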